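/- Let $N$ be a natural number and $p>1$ a real number. Let $\mathcal F$ be a family of domains (nonempty connected open sets) $\Omega\subset\mathbb R^N$. For $\delta>0$ write $\Omega^\delta=\{x\in\Omega:\ d(x,\partial\Omega)>\delta\}$, and let $\|u\|_{W^{1,p}(\Omega)}=\big(\int_\Omega|u|^p\,dx+\int_\Omega|\nabla u|^p\,dx\big)^{1/p}$ be the norm of the Sobolev space $W^{1,p}(\Omega)$ of real functions. Assume: (f1) There exists $R>0$ such that $\Omega\subset B(0,R)$ for every $\Omega\in\mathcal F$. (f2) There exist $q\in(p,\infty]$ and $C_S>0$ such that for every $\Omega\in\mathcal F$ and every $u\in W^{1,p}(\Omega)$, $$\|u\|_{L^q(\Omega)}\le C_S\,\|u\|_{W^{1,p}(\Omega)}.$$ (f3) For every $\varepsilon>0$ there exists $\delta>0$ such that for every $\Omega\in\mathcal F$ there is a connected set $U\subset\Omega^\delta$ (possibly empty) with $|\Omega\setminus U|<\varepsilon$, where $|\cdot|$ denotes Lebesgue (outer) measure. Then there exists $C>0$ such that for every $\Omega\in\mathcal F$, $$\int_\Omega|u|^p\,dx\le C\int_\Omega|\nabla u|^p\,dx\qquad\text{for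 all }u\in W^{1,p}(\Omega)\text{ with }\int_\Omega u\,dx=0.$$ -/

import Mathlib

open MeasureTheory
open scoped ENNReal ContDiff

/-- A domain of `ℝ^N`: a nonempty connected open set. -/
def IsDomainSet {N : ℕ} (Ω : Set (EuclideanSpace ℝ (Fin N))) : Prop :=
  IsOpen Ω ∧ IsConnected Ω

/-- The set `Ω^δ = {x ∈ Ω : d(x, ∂Ω) > δ}`. The extended distance is used, so that the distance to
an empty boundary is `∞`. -/
def innerSet {N : ℕ} (Ω : Set (EuclideanSpace ℝ (Fin N))) (δ : ℝ) :
    Set (EuclideanSpace ℝ (Fin N)) :=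
  {x | x ∈ Ω ∧ ENNReal.ofReal δ < Metric.infEDist x (frontier Ω)}

/-- `g` is a weak gradient of `u` on `Ω`: for each coordinate `i` and each test function
`φ ∈ C_c^∞(Ω)`, `∫_Ω u ∂ᵢφ = - ∫_Ω gᵢ φ`. This is used only for `u`, `g` in `L^p(Ω)`, `p ≥ 1`,
where all these integrals converge. -/
def IsWeakGradient {N : ℕ} (Ω : Set (EuclideanSpace ℝ (Fin N)))
    (u : EuclideanSpace ℝ (Fin N) → ℝ)
    (g : EuclideanSpace ℝ (Fin N) → EuclideanSpace ℝ (Fin N)) : Prop :=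
  ∀ φ : EuclideanSpace ℝ (Fin N) → ℝ,
    ContDiff ℝ ∞ φ → HasCompactSupport φ → tsupport φ ⊆ Ω →
    ∀ i : Fin N,
      ∫ x in Ω, u x * fderiv ℝ φ x (EuclideanSpace.single i 1) = - ∫ x in Ω, g x i * φ x

/-- `u ∈ W^{1,p}(Ω)` and `∇u = g` (the weak gradient, which is unique up to null sets):
`u ∈ L^p(Ω)`, `g ∈ L^p(Ω; ℝ^N)`, and `g` is a weak gradient of `u` on `Ω`. -/
structure MemSobolevWithGradient {N : ℕ} (p : ℝ) (Ω : Set (EuclideanSpace ℝ (Fin N)))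
    (u : EuclideanSpace ℝ (Fin N) → ℝ)
    (g : EuclideanSpace ℝ (Fin N) → EuclideanSpace ℝ (Fin N)) : Prop where
  memLp : MemLp u (ENNReal.ofReal p) (volume.restrict Ω)
  memLp_gradient : MemLp g (ENNReal.ofReal p) (volume.restrict Ω)
  isWeakGradient : IsWeakGradient Ω u g

/-- The norm `‖u‖_{W^{1,p}(Ω)} = (‖u‖_{L^p(Ω)}^p + ‖∇u‖_{L^p(Ω)}^p)^{1/p}`, where `g = ∇u`. -/
noncomputable def sobolevNorm {N : ℕ} (p : ℝ) (Ω : Set (EuclideanSpace ℝ (Fin N)))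
    (u : EuclideanSpace ℝ (Fin N) → ℝ)
    (g : EuclideanSpace ℝ (Fin N) → EuclideanSpace ℝ (Fin N)) : ℝ≥0∞ :=
  (eLpNorm u (ENNReal.ofReal p) (volume.restrict Ω) ^ p
    + eLpNorm g (ENNReal.ofReal p) (volume.restrict Ω) ^ p) ^ (1 / p)

/-! The proof is direct, with no compactness argument. Write X and Y for the L^p norms of u and ∇u
on Ω.

Hölder's inequality and the embedding into L^q with q > p give an ε such that u has L^p norm at most
(X + Y)/4 on every subset of Ω of measure at most ε (`exists_eLpNorm_restrict_le_quarter`).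
Hypothesis (f3) then supplies δ and a connected set U, whose closure A fills Ω up to measure ε/2 and
whose points are centres of δ-balls inside Ω.

On A there is a Poincaré inequality with a constant K depending only on N, p, R and δ
(`exists_eLpNorm_sub_const_le`). It replaces u by its average v over balls of radius r = δ/4.
Translation estimates show that u - v is small in L^p and that v varies by at most a multiple of Y
over distances below r. Since A is connected and covered by a fixed number of balls of radius r/2,
the total oscillation of v on A is controlled, whatever the shape of A.

The zero mean controls the constant subtracted on A (`eLpNorm_le_of_integral_eq_zero`). Hence X ≤
2(KY + (X + Y)/4), and the finite term X/2 is absorbed on the left. -/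

open scoped Convolution

/-! ### Averages of translates in L^p. -/

/-- Jensen's inequality for powers with respect to a probability measure. -/
theorem rpow_lintegral_le_lintegral_rpow {S : Type*} [MeasurableSpace S] {ν : Measure S}
    [IsProbabilityMeasure ν] {p : ℝ} (hp : 1 < p) {f : S → ℝ≥0∞} (hf : AEMeasurable f ν) :
    (∫⁻ s, f s ∂ν) ^ p ≤ ∫⁻ s, f s ^ p ∂ν := by
  have hp0 : 0 < p := by linarith
  have h := eLpNorm_le_eLpNorm_of_exponent_le (μ := ν) (p := 1) (q := ENNReal.ofReal p)
    (ENNReal.one_le_ofReal.2 hp.le) hf.aestronglyMeasurable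
  rw [eLpNorm_one_eq_lintegral_enorm, eLpNorm_eq_lintegral_rpow_enorm_toReal (by simpa using hp0)
    ENNReal.ofReal_ne_top, ENNReal.toReal_ofReal hp0.le] at h
  simp only [enorm_eq_self] at h
  calc _ ≤ ((∫⁻ s, f s ^ p ∂ν) ^ (1 / p)) ^ p := by gcongr
    _ = _ := by rw [← ENNReal.rpow_mul, one_div_mul_cancel hp0.ne', ENNReal.rpow_one]

/-- Averaging the translates of a function does not increase its `L^p` norm. -/
theorem lintegral_rpow_average_translates_le {E S : Type*} [NormedAddCommGroup E]
    [MeasurableSpace E] [BorelSpace E] [SecondCountableTopology E] {μ : Measure E} [SFinite μ]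
    [μ.IsAddLeftInvariant] [MeasurableSpace S] {ν : Measure S} [IsProbabilityMeasure ν] {p : ℝ}
    (hp : 1 < p) {T : S → E} (hT : Measurable T) {f : E → ℝ≥0∞} (hf : Measurable f) :
    ∫⁻ x, (∫⁻ s, f (T s + x) ∂ν) ^ p ∂μ ≤ ∫⁻ x, f x ^ p ∂μ := by
  calc _ ≤ ∫⁻ x, ∫⁻ s, f (T s + x) ^ p ∂ν ∂μ := by
        gcongr with x
        exact rpow_lintegral_le_lintegral_rpow hp
          (hf.comp (hT.add_const x)).aemeasurable
    _ = ∫⁻ s, ∫⁻ x, f (T s + x) ^ p ∂μ ∂ν := by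
        rw [lintegral_lintegral_swap]
        apply Measurable.aemeasurable
        exact (hf.comp ((hT.comp measurable_snd).add measurable_fst)).pow_const p
    _ = ∫⁻ s, ∫⁻ x, f x ^ p ∂μ ∂ν := by
        congr with s
        exact lintegral_add_left_eq_self (fun x ↦ f x ^ p) (T s)
    _ = _ := by simp

/-! ### Translation estimates through mollification. -/

variable {N : ℕ} {Ω : Set (EuclideanSpace ℝ (Fin N))} {u : EuclideanSpace ℝ (Fin N) → ℝ}
  {g : EuclideanSpace ℝ (Fin N) → EuclideanSpace ℝ (Fin N)} {p : ℝ}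

/-- The mollification of a function with respect to a smooth bump function. -/
noncomputable def mollify (φ : ContDiffBump (0 : EuclideanSpace ℝ (Fin N)))
    (u : EuclideanSpace ℝ (Fin N) → ℝ) : EuclideanSpace ℝ (Fin N) → ℝ :=
  φ.normed volume ⋆[ContinuousLinearMap.lsmul ℝ ℝ, volume] u

/-- The probability measure whose density is a normalized smooth bump function. -/
noncomputable def bumpMeasure (φ : ContDiffBump (0 : EuclideanSpace ℝ (Fin N))) :
    Measure (EuclideanSpace ℝ (Fin N)) :=
  volume.withDensity fun y ↦ ENNReal.ofReal (φ.normed volume y)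

instance (φ : ContDiffBump (0 : EuclideanSpace ℝ (Fin N))) :
    IsProbabilityMeasure (bumpMeasure φ) := by
  constructor
  rw [bumpMeasure, withDensity_apply _ MeasurableSet.univ, Measure.restrict_univ,
    ← ofReal_integral_eq_lintegral_ofReal φ.integrable_normed
      (ae_of_all _ fun x ↦ φ.nonneg_normed x), φ.integral_normed, ENNReal.ofReal_one]

theorem contDiff_mollify (φ : ContDiffBump (0 : EuclideanSpace ℝ (Fin N)))
    (hu : LocallyIntegrable u) : ContDiff ℝ 1 (mollify φ u) :=
  φ.hasCompactSupport_normed.contDiff_convolution_left _ φ.contDiff_normed hu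

/-- The directional derivative of a mollification is controlled by the mollification of the norm
of the weak gradient. -/
theorem enorm_fderiv_mollify_le (φ : ContDiffBump (0 : EuclideanSpace ℝ (Fin N)))
    (hu : LocallyIntegrable u) (hg : LocallyIntegrable g) (hw : IsWeakGradient Ω u g)
    {z : EuclideanSpace ℝ (Fin N)} (hz : Metric.closedBall z φ.rOut ⊆ Ω)
    (h : EuclideanSpace ℝ (Fin N)) :
    ‖fderiv ℝ (mollify φ u) z h‖ₑ ≤ ‖h‖ₑ * ∫⁻ y, ‖g (z - y)‖ₑ ∂bumpMeasure φ := by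
  set ψ := φ.normed volume with hψ
  have hψs : ContDiff ℝ ∞ ψ := φ.contDiff_normed
  have hψc : HasCompactSupport ψ := φ.hasCompactSupport_normed
  -- The reflected bump is the test function: the minus sign from the reflection cancels the one in
  -- the definition of the weak gradient.
  set θ : EuclideanSpace ℝ (Fin N) → ℝ := fun y ↦ ψ (z - y) with hθ
  have hθs : ContDiff ℝ ∞ θ := hψs.comp (contDiff_const.sub contDiff_id)
  have hθc : HasCompactSupport θ := hψc.comp_homeomorph (Homeomorph.subLeft z)
  have hθt : tsupport θ ⊆ Metric.closedBall z φ.rOut := by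
    refine closure_minimal (fun y hy ↦ ?_) Metric.isClosed_closedBall
    have : z - y ∈ Function.support ψ := hy
    rw [hψ, φ.support_normed_eq, mem_ball_zero_iff] at this
    rw [Metric.mem_closedBall, dist_comm, dist_eq_norm]
    exact this.le
  have hθd (y e : EuclideanSpace ℝ (Fin N)) : fderiv ℝ θ y e = - fderiv ℝ ψ (z - y) e := by
    have h1 : HasFDerivAt ψ (fderiv ℝ ψ (z - y)) (z - y) :=
      (hψs.differentiable (by simp) _).hasFDerivAt
    have h2 := h1.comp y ((hasFDerivAt_const z y).sub (hasFDerivAt_id y))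
    have h3 : HasFDerivAt θ _ y := h2
    rw [h3.fderiv]
    simp
  have hd : fderiv ℝ (mollify φ u) z = _ :=
    (hψc.hasFDerivAt_convolution_left (ContinuousLinearMap.lsmul ℝ ℝ) φ.contDiff_normed hu z).fderiv
  have hint : ConvolutionExistsAt (fderiv ℝ ψ) u z
      ((ContinuousLinearMap.lsmul ℝ ℝ).precompL (EuclideanSpace ℝ (Fin N))) volume :=
    (hψc.fderiv ℝ).convolutionExists_left _ (hψs.continuous_fderiv (by simp)) hu z
  have hgi (i : Fin N) : Integrable fun y ↦ g y i * θ y := by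
    have := (hg.integrable_smul_left_of_hasCompactSupport hθs.continuous hθc)
    have := (EuclideanSpace.proj (𝕜 := ℝ) i).integrable_comp this
    simpa [mul_comm] using this
  have hi (i : Fin N) :
      fderiv ℝ (mollify φ u) z (EuclideanSpace.single i 1) = ∫ y, g y i * θ y := by
    have h1 : fderiv ℝ (mollify φ u) z (EuclideanSpace.single i 1) =
        ∫ t, fderiv ℝ ψ t (EuclideanSpace.single i 1) * u (z - t) := by
      rw [hd, convolution_def, ContinuousLinearMap.integral_apply hint]
      rfl
    have h2 : ∫ t, fderiv ℝ ψ t (EuclideanSpace.single i 1) * u (z - t) =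
        - ∫ y, u y * fderiv ℝ θ y (EuclideanSpace.single i 1) := by
      rw [← integral_sub_left_eq_self _ volume z, ← integral_neg]
      congr with y
      rw [hθd, sub_sub_cancel]
      ring
    have h3 : ∫ y in Ω, u y * fderiv ℝ θ y (EuclideanSpace.single i 1) =
        ∫ y, u y * fderiv ℝ θ y (EuclideanSpace.single i 1) := by
      refine setIntegral_eq_integral_of_forall_compl_eq_zero fun y hy ↦ ?_
      have : y ∉ tsupport (fderiv ℝ θ) := fun hy' ↦
        hy (hz (hθt (tsupport_fderiv_subset ℝ hy')))
      rw [image_eq_zero_of_notMem_tsupport this]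
      simp
    have h4 : ∫ y in Ω, g y i * θ y = ∫ y, g y i * θ y := by
      refine setIntegral_eq_integral_of_forall_compl_eq_zero fun y hy ↦ ?_
      rw [image_eq_zero_of_notMem_tsupport fun hy' ↦ hy (hz (hθt hy')), mul_zero]
    rw [h1, h2, ← h3, hw θ hθs hθc (hθt.trans hz) i, neg_neg, h4]
  have hsum : fderiv ℝ (mollify φ u) z h = ∫ y, inner ℝ h (g y) * θ y := by
    conv_lhs => rw [← (EuclideanSpace.basisFun (Fin N) ℝ).sum_repr h]
    simp only [EuclideanSpace.basisFun_repr, EuclideanSpace.basisFun_apply, map_sum, map_smul, hi,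
      smul_eq_mul]
    simp_rw [← integral_const_mul]
    rw [← integral_finsetSum _ fun i _ ↦ (hgi i).const_mul _]
    congr with y
    simp only [PiLp.inner_apply, Finset.sum_mul]
    refine Finset.sum_congr rfl fun i _ ↦ ?_
    simp
    ring
  rw [hsum]
  have hθ0 (y : EuclideanSpace ℝ (Fin N)) : ‖θ y‖ₑ = ENNReal.ofReal (ψ (z - y)) :=
    Real.enorm_eq_ofReal (φ.nonneg_normed _)
  calc _ ≤ ∫⁻ y, ‖inner ℝ h (g y) * θ y‖ₑ := enorm_integral_le_lintegral_enorm _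
    _ ≤ ∫⁻ y, ‖h‖ₑ * (ENNReal.ofReal (ψ (z - y)) * ‖g y‖ₑ) := by
        gcongr with y
        rw [enorm_mul, hθ0, mul_comm (ENNReal.ofReal _), ← mul_assoc]
        gcongr
        rw [← ofReal_norm, ← ofReal_norm, ← ofReal_norm, ← ENNReal.ofReal_mul (norm_nonneg _)]
        exact ENNReal.ofReal_le_ofReal (norm_inner_le_norm _ _)
    _ = ‖h‖ₑ * ∫⁻ y, ENNReal.ofReal (ψ (z - y)) * ‖g y‖ₑ :=
        lintegral_const_mul' _ _ enorm_ne_top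
    _ = ‖h‖ₑ * ∫⁻ y, ENNReal.ofReal (ψ y) * ‖g (z - y)‖ₑ := by
        rw [← lintegral_sub_left_eq_self _ z]
        simp
    _ = _ := by
        rw [bumpMeasure, lintegral_withDensity_eq_lintegral_mul_non_measurable₀]
        · rfl
        · exact φ.continuous_normed.measurable.ennreal_ofReal.aemeasurable
        · exact ae_of_all _ fun _ ↦ ENNReal.ofReal_lt_top

/-- The `L^p` norm of a difference of a mollified Sobolev function. -/
theorem lintegral_enorm_mollify_sub_rpow_le (hp : 1 < p)
    (φ : ContDiffBump (0 : EuclideanSpace ℝ (Fin N)))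
    (hu : LocallyIntegrable u) (hg : LocallyIntegrable g) (hgm : Measurable g)
    (hw : IsWeakGradient Ω u g) {S : Set (EuclideanSpace ℝ (Fin N))} (hS : MeasurableSet S)
    {h : EuclideanSpace ℝ (Fin N)}
    (hSΩ : ∀ x ∈ S, Metric.closedBall x (‖h‖ + φ.rOut) ⊆ Ω) :
    ∫⁻ x in S, ‖mollify φ u (x + h) - mollify φ u x‖ₑ ^ p ≤ ‖h‖ₑ ^ p * ∫⁻ x, ‖g x‖ₑ ^ p := by
  have hp0 : 0 < p := by linarith
  have : IsProbabilityMeasure ((volume : Measure ℝ).restrict (Set.Icc 0 1)) := ⟨by simp⟩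
  -- Averaging over the segment from x to x + h and over the bump together makes the difference a
  -- single average of translates of g, by the vectors τh - y.
  set ν := ((volume : Measure ℝ).restrict (Set.Icc 0 1)).prod (bumpMeasure φ) with hν
  have hpt (x) (hx : x ∈ S) : ‖mollify φ u (x + h) - mollify φ u x‖ₑ ≤
      ‖h‖ₑ * ∫⁻ s : ℝ × EuclideanSpace ℝ (Fin N), ‖g ((s.1 • h - s.2) + x)‖ₑ ∂ν := by
    have hc := contDiff_mollify φ hu
    have hline : ContDiff ℝ 1 fun τ : ℝ ↦ mollify φ u (x + τ • h) :=
      hc.comp (contDiff_const.add (contDiff_id.smul contDiff_const))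
    have hder (τ : ℝ) : deriv (fun τ : ℝ ↦ mollify φ u (x + τ • h)) τ =
        fderiv ℝ (mollify φ u) (x + τ • h) h := by
      have h1 : HasDerivAt (fun τ : ℝ ↦ x + τ • h) h τ := by
        simpa using ((hasDerivAt_id τ).smul_const h).const_add x
      exact ((hc.differentiable (by simp) _).hasFDerivAt.comp_hasDerivAt τ h1).deriv
    have h1 := enorm_sub_le_lintegral_deriv_of_contDiffOn_Icc hline.contDiffOn zero_le_one
    simp only [one_smul, zero_smul, add_zero] at h1
    refine h1.trans ?_
    rw [hν, lintegral_prod _ (by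
      apply Measurable.aemeasurable
      exact (hgm.comp (((measurable_fst.smul_const h).sub measurable_snd).add_const x)).enorm),
      ← lintegral_const_mul' _ _ enorm_ne_top]
    refine setLIntegral_mono_ae' measurableSet_Icc (ae_of_all _ fun τ hτ ↦ ?_)
    rw [hder]
    refine (enorm_fderiv_mollify_le φ hu hg hw ?_ h).trans_eq ?_
    · refine Set.Subset.trans (Metric.closedBall_subset_closedBall' ?_) (hSΩ x hx)
      rw [dist_eq_norm, add_sub_cancel_left, norm_smul, Real.norm_of_nonneg hτ.1]
      nlinarith [norm_nonneg h, hτ.2]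
    · congr with y
      congr 2
      abel
  calc _ ≤ ∫⁻ x in S, (‖h‖ₑ * ∫⁻ s : ℝ × EuclideanSpace ℝ (Fin N),
          ‖g ((s.1 • h - s.2) + x)‖ₑ ∂ν) ^ p :=
        setLIntegral_mono_ae' hS (ae_of_all _ fun x hx ↦ by gcongr; exact hpt x hx)
    _ ≤ ∫⁻ x, (‖h‖ₑ * ∫⁻ s : ℝ × EuclideanSpace ℝ (Fin N),
          ‖g ((s.1 • h - s.2) + x)‖ₑ ∂ν) ^ p := setLIntegral_le_lintegral _ _
    _ = ‖h‖ₑ ^ p * ∫⁻ x, (∫⁻ s : ℝ × EuclideanSpace ℝ (Fin N),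
          ‖g ((s.1 • h - s.2) + x)‖ₑ ∂ν) ^ p := by
        simp_rw [ENNReal.mul_rpow_of_nonneg _ _ hp0.le]
        exact lintegral_const_mul' _ _ (ENNReal.rpow_ne_top_of_nonneg hp0.le enorm_ne_top)
    _ ≤ _ := by
        gcongr ‖h‖ₑ ^ p * ?_
        exact lintegral_rpow_average_translates_le (μ := volume) (ν := ν) hp
          (T := fun s : ℝ × EuclideanSpace ℝ (Fin N) ↦ s.1 • h - s.2)
          ((measurable_fst.smul_const h).sub measurable_snd) hgm.enorm

/-- The `L^p` norm of a difference of a Sobolev function is controlled by the `L^p` norm of the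
gradient. -/
theorem lintegral_enorm_sub_rpow_le (hp : 1 < p)
    (hu : LocallyIntegrable u) (hg : LocallyIntegrable g) (hgm : Measurable g)
    (hw : IsWeakGradient Ω u g) {S : Set (EuclideanSpace ℝ (Fin N))} (hS : MeasurableSet S)
    {h : EuclideanSpace ℝ (Fin N)} {ρ : ℝ} (hρ : ‖h‖ < ρ)
    (hSΩ : ∀ x ∈ S, Metric.closedBall x ρ ⊆ Ω) :
    ∫⁻ x in S, ‖u (x + h) - u x‖ₑ ^ p ≤ ‖h‖ₑ ^ p * ∫⁻ x, ‖g x‖ₑ ^ p := by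
  -- Mollification radii tending to 0 with ‖h‖ + a n ≤ ρ, so that all balls involved stay in Ω.
  set a : ℕ → ℝ := fun n ↦ (ρ - ‖h‖) * (1 / ((n : ℝ) + 1)) with ha
  have ha0 (n) : 0 < a n := mul_pos (by linarith) Nat.one_div_pos_of_nat
  have ha1 (n) : a n ≤ ρ - ‖h‖ := by
    refine mul_le_of_le_one_right (by linarith) ?_
    rw [div_le_one (by positivity)]
    linarith [(Nat.cast_nonneg n : (0 : ℝ) ≤ n)]
  have hlim : Filter.Tendsto a Filter.atTop (nhds 0) := by
    simpa only [mul_zero] using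
      (tendsto_one_div_add_atTop_nhds_zero_nat (𝕜 := ℝ)).const_mul (ρ - ‖h‖)
  -- The fixed ratio 2 of outer to inner radius is what the almost everywhere convergence of the
  -- mollifications requires.
  let φ : ℕ → ContDiffBump (0 : EuclideanSpace ℝ (Fin N)) := fun n ↦
    ⟨a n / 2, a n, by linarith [ha0 n], by linarith [ha0 n]⟩
  have hae : ∀ᵐ x, Filter.Tendsto (fun n ↦ mollify (φ n) u x) Filter.atTop (nhds (u x)) :=
    ContDiffBump.ae_convolution_tendsto_right_of_locallyIntegrable (φ := φ) (K := 2) hlim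
      (Filter.Eventually.of_forall fun n ↦ by simp [φ]; linarith) hu
  have hae' : ∀ᵐ x, Filter.Tendsto (fun n ↦ mollify (φ n) u (x + h)) Filter.atTop
      (nhds (u (x + h))) :=
    (measurePreserving_add_right volume h).quasiMeasurePreserving.ae hae
  have hcont (n) : Continuous (mollify (φ n) u) := (contDiff_mollify _ hu).continuous
  -- Fatou's lemma passes the bound, which does not depend on the mollification, to the limit.
  calc _ = ∫⁻ x in S, Filter.liminf
          (fun n ↦ ‖mollify (φ n) u (x + h) - mollify (φ n) u x‖ₑ ^ p) Filter.atTop := by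
        refine lintegral_congr_ae (ae_restrict_of_ae ?_)
        filter_upwards [hae, hae'] with x h1 h2
        exact ((ENNReal.continuous_rpow_const.tendsto _).comp
          ((continuous_enorm.tendsto _).comp (h2.sub h1))).liminf_eq.symm
    _ ≤ Filter.liminf (fun n ↦ ∫⁻ x in S,
          ‖mollify (φ n) u (x + h) - mollify (φ n) u x‖ₑ ^ p) Filter.atTop := by
        refine lintegral_liminf_le fun n ↦ ?_
        have : Continuous fun x ↦ mollify (φ n) u (x + h) - mollify (φ n) u x :=
          ((hcont n).comp (continuous_id.add continuous_const)).sub (hcont n)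
        exact this.measurable.enorm.pow_const p
    _ ≤ Filter.liminf (fun _ : ℕ ↦ ‖h‖ₑ ^ p * ∫⁻ x, ‖g x‖ₑ ^ p) Filter.atTop := by
        refine Filter.liminf_le_liminf (Filter.Eventually.of_forall fun n ↦ ?_)
        refine lintegral_enorm_mollify_sub_rpow_le hp (φ n) hu hg hgm hw hS fun x hx ↦ ?_
        exact (Metric.closedBall_subset_closedBall
          (by simp only [φ]; linarith [ha1 n])).trans (hSΩ x hx)
    _ = _ := Filter.liminf_const _

/-! ### Ball averages and a Poincaré inequality away from the boundary. -/

/-- A continuous function whose local oscillation at scale `r` is at most `κ` has global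
oscillation at most `n * κ` on a preconnected set that is covered by `n` balls of radius `r / 2`. -/
theorem edist_le_card_mul_of_isPreconnected {X : Type*} [PseudoMetricSpace X] {A : Set X}
    (hA : IsPreconnected A) {t : Finset X} {r : ℝ} (hAt : A ⊆ ⋃ y ∈ t, Metric.ball y (r / 2))
    {v : X → ℝ} (hv : ContinuousOn v A) {κ : ℝ≥0∞}
    (hκ : ∀ x ∈ A, ∀ y ∈ A, dist x y < r → edist (v x) (v y) ≤ κ) {x y : X} (hx : x ∈ A)
    (hy : y ∈ A) : edist (v x) (v y) ≤ t.card * κ := by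
  -- Instead of a chain of balls, Lebesgue measure on the line is used: the image is an interval,
  -- and its length is at most the sum of the diameters of the pieces.
  have h1 : Set.uIcc (v x) (v y) ⊆ v '' A :=
    (hA.image v hv).ordConnected.uIcc_subset ⟨x, hx, rfl⟩ ⟨y, hy, rfl⟩
  have h2 : v '' A ⊆ ⋃ z ∈ t, v '' (A ∩ Metric.ball z (r / 2)) := by
    rintro _ ⟨w, hw, rfl⟩
    obtain ⟨z, hz, hwz⟩ := Set.mem_iUnion₂.1 (hAt hw)
    exact Set.mem_iUnion₂.2 ⟨z, hz, w, ⟨hw, hwz⟩, rfl⟩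
  calc edist (v x) (v y) = volume (Set.uIcc (v x) (v y)) := by
        rw [Set.uIcc, Real.volume_Icc, max_sub_min_eq_abs', edist_dist, Real.dist_eq]
    _ ≤ volume (⋃ z ∈ t, v '' (A ∩ Metric.ball z (r / 2))) := measure_mono (h1.trans h2)
    _ ≤ ∑ z ∈ t, volume (v '' (A ∩ Metric.ball z (r / 2))) := measure_biUnion_finset_le _ _
    _ ≤ ∑ _z ∈ t, κ := by
        refine Finset.sum_le_sum fun z _ ↦ (Real.volume_le_diam _).trans ?_
        refine Metric.ediam_le ?_
        rintro _ ⟨a, ⟨ha, haz⟩, rfl⟩ _ ⟨b, ⟨hb, hbz⟩, rfl⟩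
        refine hκ a ha b hb ?_
        rw [Metric.mem_ball] at haz hbz
        linarith [dist_triangle_right a b z]
    _ = t.card * κ := by simp

/-- The average of `u` over the ball of radius `r` around a point. -/
noncomputable def ballAverage (r : ℝ) (u : EuclideanSpace ℝ (Fin N) → ℝ)
    (x : EuclideanSpace ℝ (Fin N)) : ℝ :=
  ∫ z, u (x + z) ∂ProbabilityTheory.cond volume (Metric.ball 0 r)

theorem isProbabilityMeasure_cond_ball {r : ℝ} (hr : 0 < r) : IsProbabilityMeasure
    (ProbabilityTheory.cond (volume : Measure (EuclideanSpace ℝ (Fin N))) (Metric.ball 0 r)) :=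
  ProbabilityTheory.cond_isProbabilityMeasure_of_finite (Metric.measure_ball_pos _ _ hr).ne'
    measure_ball_lt_top.ne

theorem integrable_add_left_cond_ball (hu : LocallyIntegrable u) {r : ℝ} (hr : 0 < r)
    (x : EuclideanSpace ℝ (Fin N)) :
    Integrable (fun z ↦ u (x + z)) (ProbabilityTheory.cond volume (Metric.ball 0 r)) := by
  refine Integrable.smul_measure ?_
    (ENNReal.inv_ne_top.2 (Metric.measure_ball_pos volume _ hr).ne')
  have h := (measurePreserving_add_left volume x).integrableOn_comp_preimage
    (measurableEmbedding_addLeft x) (f := u) (s := Metric.ball x r)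
  rw [preimage_add_ball, sub_self] at h
  exact h.2 ((hu.integrableOn_isCompact (isCompact_closedBall x r)).mono_set
    Metric.ball_subset_closedBall)

/-- Jensen's inequality turns the L^p translation estimate on the ball around x into a pointwise
bound, at the price of the factor |B_r|^(-1/p). This yields both the continuity and the local
oscillation of the average. The radius 4r leaves slack: 2r would do. -/
theorem enorm_ballAverage_sub_le (hp : 1 < p) (hu : LocallyIntegrable u) (hum : Measurable u)
    (hg : LocallyIntegrable g) (hgm : Measurable g) (hw : IsWeakGradient Ω u g) {r : ℝ}
    (hr : 0 < r) {x h : EuclideanSpace ℝ (Fin N)} (hh : ‖h‖ < r)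
    (hx : Metric.ball x (4 * r) ⊆ Ω) :
    ‖ballAverage r u (x + h) - ballAverage r u x‖ₑ ≤
      (volume (Metric.ball (0 : EuclideanSpace ℝ (Fin N)) r))⁻¹ ^ (1 / p) * ‖h‖ₑ *
        eLpNorm g (ENNReal.ofReal p) volume := by
  have hp0 : 0 < p := by linarith
  have := isProbabilityMeasure_cond_ball (N := N) hr
  have h1 : ‖ballAverage r u (x + h) - ballAverage r u x‖ₑ ^ p ≤
      (volume (Metric.ball (0 : EuclideanSpace ℝ (Fin N)) r))⁻¹ *
        (‖h‖ₑ ^ p * ∫⁻ x, ‖g x‖ₑ ^ p) := by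
    rw [ballAverage, ballAverage, ← integral_sub (integrable_add_left_cond_ball hu hr _)
      (integrable_add_left_cond_ball hu hr _)]
    have hm : Measurable fun z ↦ ‖u (x + h + z) - u (x + z)‖ₑ :=
      ((hum.comp (measurable_const_add _)).sub (hum.comp (measurable_const_add _))).enorm
    calc _ ≤ (∫⁻ z, ‖u (x + h + z) - u (x + z)‖ₑ
            ∂ProbabilityTheory.cond volume (Metric.ball 0 r)) ^ p := by
          gcongr
          exact enorm_integral_le_lintegral_enorm _
      _ ≤ ∫⁻ z, ‖u (x + h + z) - u (x + z)‖ₑ ^ p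
            ∂ProbabilityTheory.cond volume (Metric.ball 0 r) :=
          rpow_lintegral_le_lintegral_rpow hp hm.aemeasurable
      _ = (volume (Metric.ball (0 : EuclideanSpace ℝ (Fin N)) r))⁻¹ *
            ∫⁻ z in Metric.ball 0 r, ‖u (x + h + z) - u (x + z)‖ₑ ^ p := by
          rw [ProbabilityTheory.cond, lintegral_smul_measure, smul_eq_mul]
      _ = (volume (Metric.ball (0 : EuclideanSpace ℝ (Fin N)) r))⁻¹ *
            ∫⁻ y in Metric.ball x r, ‖u (y + h) - u y‖ₑ ^ p := by
          rw [← (measurePreserving_add_left volume x).setLIntegral_comp_preimage_emb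
            (measurableEmbedding_addLeft x) _ (Metric.ball x r), preimage_add_ball, sub_self]
          simp only [add_right_comm]
      _ ≤ _ := by
          gcongr
          refine lintegral_enorm_sub_rpow_le hp hu hg hgm hw measurableSet_ball hh fun y hy ↦ ?_
          refine Set.Subset.trans (fun z hz ↦ ?_) hx
          rw [Metric.mem_ball] at hy ⊢
          rw [Metric.mem_closedBall] at hz
          linarith [dist_triangle z y x]
  rw [eLpNorm_eq_lintegral_rpow_enorm_toReal (by simpa using hp0) ENNReal.ofReal_ne_top,
    ENNReal.toReal_ofReal hp0.le]
  refine (ENNReal.rpow_le_rpow_iff hp0).1 (h1.trans_eq ?_)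
  rw [ENNReal.mul_rpow_of_nonneg _ _ hp0.le, ENNReal.mul_rpow_of_nonneg _ _ hp0.le,
    ← ENNReal.rpow_mul, ← ENNReal.rpow_mul, one_div_mul_cancel hp0.ne', ENNReal.rpow_one,
    ENNReal.rpow_one, mul_assoc]

theorem measurable_ballAverage (hum : Measurable u) {r : ℝ} (hr : 0 < r) :
    Measurable (ballAverage r u) := by
  have := isProbabilityMeasure_cond_ball (N := N) hr
  have h : StronglyMeasurable
      fun s : EuclideanSpace ℝ (Fin N) × EuclideanSpace ℝ (Fin N) ↦ u (s.1 + s.2) :=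
    (hum.comp (measurable_fst.add measurable_snd)).stronglyMeasurable
  exact h.integral_prod_right'.measurable

/-- The difference is an average of u(x) - u(x + z) over ‖z‖ < r, so Jensen and Tonelli reduce it to
the translation estimate for each z. -/
theorem eLpNorm_sub_ballAverage_le (hp : 1 < p) (hu : LocallyIntegrable u) (hum : Measurable u)
    (hg : LocallyIntegrable g) (hgm : Measurable g) (hw : IsWeakGradient Ω u g) {r : ℝ}
    (hr : 0 < r) {A : Set (EuclideanSpace ℝ (Fin N))} (hA : MeasurableSet A)
    (hAΩ : ∀ x ∈ A, Metric.ball x (4 * r) ⊆ Ω) :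
    eLpNorm (u - ballAverage r u) (ENNReal.ofReal p) (volume.restrict A) ≤
      ENNReal.ofReal r * eLpNorm g (ENNReal.ofReal p) volume := by
  have hp0 : 0 < p := by linarith
  have := isProbabilityMeasure_cond_ball (N := N) hr
  have h1 : ∫⁻ x in A, ‖u x - ballAverage r u x‖ₑ ^ p ≤
      ENNReal.ofReal r ^ p * ∫⁻ x, ‖g x‖ₑ ^ p := by
    calc _ ≤ ∫⁻ x in A, ∫⁻ z, ‖u (x + z) - u x‖ₑ ^ p
            ∂ProbabilityTheory.cond volume (Metric.ball 0 r) := by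
          gcongr with x
          have hm : Measurable fun z ↦ ‖u (x + z) - u x‖ₑ :=
            ((hum.comp (measurable_const_add _)).sub_const _).enorm
          have hi := integrable_add_left_cond_ball hu hr x
          have : u x - ballAverage r u x = - ∫ z, (u (x + z) - u x)
              ∂ProbabilityTheory.cond volume (Metric.ball 0 r) := by
            rw [integral_sub hi (integrable_const _), integral_const, ballAverage]
            simp
          rw [this, enorm_neg]
          refine le_trans ?_ (rpow_lintegral_le_lintegral_rpow hp hm.aemeasurable)
          gcongr
          exact enorm_integral_le_lintegral_enorm _
      _ = ∫⁻ z, (∫⁻ x in A, ‖u (x + z) - u x‖ₑ ^ p)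
            ∂ProbabilityTheory.cond volume (Metric.ball 0 r) := by
          rw [lintegral_lintegral_swap]
          apply Measurable.aemeasurable
          exact (((hum.comp (measurable_fst.add measurable_snd)).sub
            (hum.comp measurable_fst)).enorm).pow_const p
      _ ≤ ∫⁻ _z : EuclideanSpace ℝ (Fin N), (ENNReal.ofReal r ^ p * ∫⁻ x, ‖g x‖ₑ ^ p)
            ∂ProbabilityTheory.cond volume (Metric.ball 0 r) := by
          refine lintegral_mono_ae ?_
          filter_upwards [ProbabilityTheory.ae_cond_mem measurableSet_ball] with z hz
          rw [mem_ball_zero_iff] at hz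
          refine (lintegral_enorm_sub_rpow_le hp hu hg hgm hw hA hz fun x hx ↦ ?_).trans ?_
          · exact (Metric.closedBall_subset_ball (by linarith)).trans (hAΩ x hx)
          · gcongr
            rw [← ofReal_norm]
            exact ENNReal.ofReal_le_ofReal hz.le
      _ = _ := by rw [lintegral_const, measure_univ, mul_one]
  rw [eLpNorm_eq_lintegral_rpow_enorm_toReal (by simpa using hp0) ENNReal.ofReal_ne_top,
    eLpNorm_eq_lintegral_rpow_enorm_toReal (by simpa using hp0) ENNReal.ofReal_ne_top,
    ENNReal.toReal_ofReal hp0.le]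
  calc _ ≤ (ENNReal.ofReal r ^ p * ∫⁻ x, ‖g x‖ₑ ^ p) ^ (1 / p) := by
        gcongr
        exact h1
    _ = _ := by
        rw [ENNReal.mul_rpow_of_nonneg _ _ (by positivity), ← ENNReal.rpow_mul,
          mul_one_div_cancel hp0.ne', ENNReal.rpow_one]

/-- A Poincaré inequality on a bounded preconnected set that stays away from the boundary of the
domain, with a constant that depends only on the distance and the bound. -/
theorem exists_eLpNorm_sub_const_le (N : ℕ) (hp : 1 < p) (R : ℝ) {δ : ℝ} (hδ : 0 < δ) :
    ∃ K : ℝ≥0∞, K ≠ ⊤ ∧ ∀ (Ω A : Set (EuclideanSpace ℝ (Fin N)))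
      (u : EuclideanSpace ℝ (Fin N) → ℝ)
      (g : EuclideanSpace ℝ (Fin N) → EuclideanSpace ℝ (Fin N)),
      MeasurableSet A → IsPreconnected A → A ⊆ Metric.ball 0 R →
      (∀ x ∈ A, Metric.ball x δ ⊆ Ω) → LocallyIntegrable u → Measurable u →
      MemLp g (ENNReal.ofReal p) volume → Measurable g → IsWeakGradient Ω u g →
      ∃ c : ℝ, eLpNorm (fun x ↦ u x - c) (ENNReal.ofReal p) (volume.restrict A) ≤
        K * eLpNorm g (ENNReal.ofReal p) volume := by
  have hp0 : 0 < p := by linarith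
  obtain ⟨r, hr, rfl⟩ : ∃ r : ℝ, 0 < r ∧ 4 * r = δ := ⟨δ / 4, by linarith, by ring⟩
  obtain ⟨t, -, ht, hcov⟩ := finite_cover_balls_of_compact
    (isCompact_closedBall (0 : EuclideanSpace ℝ (Fin N)) R) (half_pos hr)
  lift t to Finset (EuclideanSpace ℝ (Fin N)) using ht
  set b := (volume (Metric.ball (0 : EuclideanSpace ℝ (Fin N)) r))⁻¹ ^ (1 / p) with hb
  have hbt : b ≠ ⊤ := ENNReal.rpow_ne_top_of_nonneg (by positivity)
    (ENNReal.inv_ne_top.2 (Metric.measure_ball_pos volume _ hr).ne')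
  set V := volume (Metric.ball (0 : EuclideanSpace ℝ (Fin N)) R) ^ (1 / p) with hV
  have hVt : V ≠ ⊤ := ENNReal.rpow_ne_top_of_nonneg (by positivity) measure_ball_lt_top.ne
  -- The first term bounds u - v; the second is the oscillation of v times |B_R|^(1/p), which bounds
  -- |A|^(1/p).
  refine ⟨ENNReal.ofReal r + t.card * (b * ENNReal.ofReal r) * V,
    by finiteness, ?_⟩
  intro Ω A u g hA hAc hAR hAΩ hu hum hgp hgm hw
  have hg : LocallyIntegrable g := hgp.locallyIntegrable (ENNReal.one_le_ofReal.2 hp.le)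
  set G := eLpNorm g (ENNReal.ofReal p) volume with hG
  have hGt : G ≠ ⊤ := hgp.2.ne
  rcases A.eq_empty_or_nonempty with rfl | ⟨x₀, hx₀⟩
  · exact ⟨0, by simp⟩
  set v := ballAverage r u with hv
  have hstep (x) (hx : x ∈ A) (y) (hxy : dist x y < r) :
      edist (v x) (v y) ≤ b * edist x y * G := by
    have := enorm_ballAverage_sub_le hp hu hum hg hgm hw hr (x := x) (h := y - x)
      (by rwa [← dist_eq_norm, dist_comm]) (hAΩ x hx)
    rwa [add_sub_cancel, ← edist_eq_enorm_sub, ← edist_eq_enorm_sub, edist_comm, edist_comm y]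
      at this
  have hcont : ContinuousOn v A := by
    intro x hx
    apply ContinuousAt.continuousWithinAt
    rw [ContinuousAt, tendsto_iff_edist_tendsto_0]
    have hlim : Filter.Tendsto (fun y ↦ b * edist x y * G) (nhds x) (nhds 0) := by
      have h0 : Filter.Tendsto (fun y ↦ edist x y) (nhds x) (nhds 0) := by
        have : Continuous fun y ↦ edist x y := continuous_const.edist continuous_id
        simpa using this.tendsto x
      simpa using ENNReal.Tendsto.mul_const (b := G)
        (ENNReal.Tendsto.const_mul (a := b) h0 (Or.inr hbt)) (Or.inr hGt)
    refine tendsto_of_tendsto_of_tendsto_of_le_of_le' tendsto_const_nhds hlim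
      (Filter.Eventually.of_forall fun _ ↦ zero_le) ?_
    filter_upwards [Metric.ball_mem_nhds x hr] with y hy
    rw [edist_comm]
    exact hstep x hx y (by rwa [dist_comm])
  have hosc (x) (hx : x ∈ A) : ‖v x - v x₀‖ₑ ≤ t.card * (b * ENNReal.ofReal r * G) := by
    rw [← edist_eq_enorm_sub]
    refine edist_le_card_mul_of_isPreconnected hAc (r := r)
      ((hAR.trans Metric.ball_subset_closedBall).trans hcov) hcont
      (fun y hy z _ hyz ↦ (hstep y hy z hyz).trans ?_) hx hx₀
    gcongr
    rw [edist_dist]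
    exact ENNReal.ofReal_le_ofReal hyz.le
  have hvm : Measurable v := measurable_ballAverage hum hr
  refine ⟨v x₀, ?_⟩
  calc eLpNorm (fun x ↦ u x - v x₀) (ENNReal.ofReal p) (volume.restrict A)
      = eLpNorm ((u - v) + fun x ↦ v x - v x₀) (ENNReal.ofReal p) (volume.restrict A) := by
        congr 1
        ext x
        simp
    _ ≤ eLpNorm (u - v) (ENNReal.ofReal p) (volume.restrict A) +
          eLpNorm (fun x ↦ v x - v x₀) (ENNReal.ofReal p) (volume.restrict A) :=
        eLpNorm_add_le (hum.sub hvm).aestronglyMeasurable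
          (hvm.sub_const _).aestronglyMeasurable (ENNReal.one_le_ofReal.2 hp.le)
    _ ≤ ENNReal.ofReal r * G + t.card * (b * ENNReal.ofReal r * G) * V := by
        gcongr
        · exact eLpNorm_sub_ballAverage_le hp hu hum hg hgm hw hr hA hAΩ
        · rw [eLpNorm_eq_lintegral_rpow_enorm_toReal (by simpa using hp0) ENNReal.ofReal_ne_top,
            ENNReal.toReal_ofReal hp0.le]
          calc _ ≤ (∫⁻ x in A, (t.card * (b * ENNReal.ofReal r * G)) ^ p) ^ (1 / p) := by
                gcongr ?_ ^ (1 / p)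
                refine setLIntegral_mono_ae' hA (ae_of_all _ fun x hx ↦ ?_)
                gcongr
                exact hosc x hx
            _ = t.card * (b * ENNReal.ofReal r * G) * volume A ^ (1 / p) := by
                rw [setLIntegral_const, ENNReal.mul_rpow_of_nonneg _ _ (by positivity),
                  ← ENNReal.rpow_mul, mul_one_div_cancel hp0.ne', ENNReal.rpow_one]
            _ ≤ _ := by
                rw [hV]
                gcongr
    _ = _ := by ring

/-! ### Zero mean and non-concentration. -/

/-- If `u` has mean zero, its `L^p` norm is controlled by its oscillation on a set `A` of at least
half the measure and its norm on the complement. -/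
theorem eLpNorm_le_of_integral_eq_zero {S : Type*} [MeasurableSpace S] {μ : Measure S}
    [IsFiniteMeasure μ] (hp : 1 < p) {u : S → ℝ} (hu : MemLp u (ENNReal.ofReal p) μ)
    (h0 : ∫ x, u x ∂μ = 0) {A : Set S} (hA : MeasurableSet A) (hle : μ Aᶜ ≤ μ A) (c : ℝ) :
    eLpNorm u (ENNReal.ofReal p) μ ≤
      2 * (eLpNorm (fun x ↦ u x - c) (ENNReal.ofReal p) (μ.restrict A) +
        eLpNorm u (ENNReal.ofReal p) (μ.restrict Aᶜ)) := by
  have hp0 : 0 < p := by linarith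
  have hp1 : (1 : ℝ≥0∞) ≤ ENNReal.ofReal p := ENNReal.one_le_ofReal.2 hp.le
  have hs : 0 ≤ 1 - 1 / p := by
    rw [sub_nonneg, div_le_one hp0]
    exact hp.le
  set a := eLpNorm (fun x ↦ u x - c) (ENNReal.ofReal p) (μ.restrict A) with ha
  set b := eLpNorm u (ENNReal.ofReal p) (μ.restrict Aᶜ) with hb
  have hi : Integrable u μ := hu.integrable hp1
  have hcm : AEStronglyMeasurable (fun x ↦ u x - c) μ :=
    hu.1.sub aestronglyMeasurable_const
  have hHol {f : S → ℝ} (hf : AEStronglyMeasurable f μ) (B : Set S) :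
      ∫⁻ x in B, ‖f x‖ₑ ∂μ ≤
        eLpNorm f (ENNReal.ofReal p) (μ.restrict B) * μ B ^ (1 - 1 / p) := by
    have := eLpNorm_le_eLpNorm_mul_rpow_measure_univ (μ := μ.restrict B) hp1 hf.restrict
    rwa [eLpNorm_one_eq_lintegral_enorm, Measure.restrict_apply_univ, ENNReal.toReal_one,
      div_one, ENNReal.toReal_ofReal hp0.le] at this
  have hc1 : ‖c‖ₑ * μ A ≤ (a + b) * μ A ^ (1 - 1 / p) := by
    -- The zero mean enters here: the integral of u over A is minus its integral over the
    -- complement.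
    have hsplit : c * μ.real A = - (∫ x in Aᶜ, u x ∂μ) - ∫ x in A, (u x - c) ∂μ := by
      have h1 := integral_add_compl hA hi
      rw [integral_sub hi.integrableOn (integrable_const c), setIntegral_const, smul_eq_mul]
      linarith
    calc ‖c‖ₑ * μ A = ‖c * μ.real A‖ₑ := by
          rw [enorm_mul, Real.enorm_eq_ofReal measureReal_nonneg, ofReal_measureReal]
      _ ≤ ‖∫ x in Aᶜ, u x ∂μ‖ₑ + ‖∫ x in A, (u x - c) ∂μ‖ₑ := by
          rw [hsplit, ← enorm_neg (∫ x in Aᶜ, u x ∂μ)]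
          exact enorm_sub_le
      _ ≤ ∫⁻ x in Aᶜ, ‖u x‖ₑ ∂μ + ∫⁻ x in A, ‖u x - c‖ₑ ∂μ :=
          add_le_add (enorm_integral_le_lintegral_enorm _) (enorm_integral_le_lintegral_enorm _)
      _ ≤ b * μ Aᶜ ^ (1 - 1 / p) + a * μ A ^ (1 - 1 / p) :=
          add_le_add (hHol hu.1 _) (hHol hcm _)
      _ ≤ b * μ A ^ (1 - 1 / p) + a * μ A ^ (1 - 1 / p) := by gcongr
      _ = _ := by ring
  have hc2 : ‖c‖ₑ * μ A ^ (1 / p) ≤ a + b := by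
    rcases eq_or_ne (μ A) 0 with hA0 | hA0
    · simp [hA0, hp0]
    · have hne : μ A ^ (1 - 1 / p) ≠ 0 := by
        simp [ENNReal.rpow_eq_zero_iff, hA0]
      have hnt : μ A ^ (1 - 1 / p) ≠ ⊤ := ENNReal.rpow_ne_top_of_nonneg hs (measure_ne_top _ _)
      refine (ENNReal.mul_le_mul_iff_left hne hnt).1 (le_trans (le_of_eq ?_) hc1)
      rw [mul_assoc, ← ENNReal.rpow_add _ _ hA0 (measure_ne_top _ _), add_sub_cancel,
        ENNReal.rpow_one]
  have hsum : eLpNorm u (ENNReal.ofReal p) μ ≤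
      eLpNorm u (ENNReal.ofReal p) (μ.restrict A) + b := by
    calc _ = eLpNorm (A.indicator u + Aᶜ.indicator u) (ENNReal.ofReal p) μ := by
          rw [Set.indicator_self_add_compl]
      _ ≤ _ := eLpNorm_add_le (hu.1.indicator hA) (hu.1.indicator hA.compl) hp1
      _ = _ := by
          rw [eLpNorm_indicator_eq_eLpNorm_restrict hA,
            eLpNorm_indicator_eq_eLpNorm_restrict hA.compl]
  have hAu : eLpNorm u (ENNReal.ofReal p) (μ.restrict A) ≤ a + (a + b) := by
    calc _ = eLpNorm ((fun x ↦ u x - c) + fun _ ↦ c) (ENNReal.ofReal p) (μ.restrict A) := by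
          congr 1
          ext x
          simp
      _ ≤ a + eLpNorm (fun _ ↦ c) (ENNReal.ofReal p) (μ.restrict A) :=
          eLpNorm_add_le hcm.restrict aestronglyMeasurable_const hp1
      _ ≤ _ := by
          gcongr
          rw [eLpNorm_const' c (by simpa using hp0) ENNReal.ofReal_ne_top,
            Measure.restrict_apply_univ, ENNReal.toReal_ofReal hp0.le]
          exact hc2
  calc _ ≤ a + (a + b) + b := hsum.trans (by gcongr)
    _ = _ := by ring

theorem sobolevNorm_le_add (hp : 1 < p) :
    sobolevNorm p Ω u g ≤ eLpNorm u (ENNReal.ofReal p) (volume.restrict Ω) +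
      eLpNorm g (ENNReal.ofReal p) (volume.restrict Ω) :=
  ENNReal.rpow_add_rpow_le_add _ _ hp.le

/-- A Sobolev embedding into `L^q` with `q > p` prevents concentration on small sets. -/
theorem exists_eLpNorm_restrict_le_quarter (N : ℕ) (hp : 1 < p) {q : ℝ≥0∞}
    (hq : ENNReal.ofReal p < q) {C : ℝ} (hC : 0 < C) :
    ∃ ε : ℝ, 0 < ε ∧ ∀ (Ω : Set (EuclideanSpace ℝ (Fin N))) (u : EuclideanSpace ℝ (Fin N) → ℝ)
      (g : EuclideanSpace ℝ (Fin N) → EuclideanSpace ℝ (Fin N)),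
      AEStronglyMeasurable u (volume.restrict Ω) →
      eLpNorm u q (volume.restrict Ω) ≤ ENNReal.ofReal C * sobolevNorm p Ω u g →
      ∀ E ⊆ Ω, volume E ≤ ENNReal.ofReal ε →
        eLpNorm u (ENNReal.ofReal p) (volume.restrict E) ≤
          (eLpNorm u (ENNReal.ofReal p) (volume.restrict Ω) +
            eLpNorm g (ENNReal.ofReal p) (volume.restrict Ω)) / 4 := by
  have hp0 : 0 < p := by linarith
  -- For q = ⊤ the convention `⊤.toReal = 0` makes the second term 0, so α = 1/p is still the Hölder
  -- exponent.
  set α := 1 / p - 1 / q.toReal with hα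
  have hα0 : 0 < α := by
    rcases eq_or_ne q ⊤ with rfl | hqt
    · simpa [hα] using hp0
    · exact sub_pos.2 (one_div_lt_one_div_of_lt hp0
        ((ENNReal.ofReal_lt_iff_lt_toReal hp0.le hqt).1 hq))
  have hC4 : 0 < 1 / (4 * C) := by positivity
  -- Chosen so that C ε^α = 1/4.
  refine ⟨(1 / (4 * C)) ^ (1 / α), by positivity, fun Ω u g hum hu E hE hvol ↦ ?_⟩
  calc _ ≤ eLpNorm u q (volume.restrict E) * volume E ^ α := by
        have := eLpNorm_le_eLpNorm_mul_rpow_measure_univ hq.le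
          (hum.mono_measure (Measure.restrict_mono hE le_rfl))
        rwa [Measure.restrict_apply_univ, ENNReal.toReal_ofReal hp0.le] at this
    _ ≤ (ENNReal.ofReal C * (eLpNorm u (ENNReal.ofReal p) (volume.restrict Ω) +
          eLpNorm g (ENNReal.ofReal p) (volume.restrict Ω))) * ENNReal.ofReal (1 / (4 * C)) := by
        gcongr
        · refine (eLpNorm_mono_measure u (Measure.restrict_mono hE le_rfl)).trans (hu.trans ?_)
          gcongr
          exact sobolevNorm_le_add hp
        · calc volume E ^ α ≤ ENNReal.ofReal ((1 / (4 * C)) ^ (1 / α)) ^ α := by gcongr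
            _ = _ := by
              rw [ENNReal.ofReal_rpow_of_nonneg (by positivity) hα0.le, ← Real.rpow_mul hC4.le,
                one_div_mul_cancel hα0.ne', Real.rpow_one]
    _ = _ := by
        rw [mul_right_comm, ← ENNReal.ofReal_mul hC.le, mul_comm,
          show C * (1 / (4 * C)) = 4⁻¹ by field_simp, ENNReal.ofReal_inv_of_pos (by norm_num),
          div_eq_mul_inv]
        simp

/-! ### Inner sets and measurable representatives. -/

/-- A ball is connected, so one that meets Ω and misses its frontier cannot leave Ω. -/
theorem ball_subset_of_le_infEDist_frontier {X : Type*} [NormedAddCommGroup X] [NormedSpace ℝ X]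
    {Ω : Set X} (hΩ : IsOpen Ω) {x : X} (hx : x ∈ Ω) {δ : ℝ} (hδ : 0 < δ)
    (hd : ENNReal.ofReal δ ≤ Metric.infEDist x (frontier Ω)) : Metric.ball x δ ⊆ Ω := by
  refine (convex_ball x δ).isPreconnected.subset_left_of_subset_union hΩ
    (isClosed_closure (s := Ω)).isOpen_compl
    (Set.disjoint_compl_right_iff_subset.2 subset_closure) (fun y hy ↦ ?_)
    ⟨x, Metric.mem_ball_self hδ, hx⟩
  by_contra hc
  rw [Set.mem_union, not_or, Set.mem_compl_iff, not_not] at hc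
  have hyf : y ∈ frontier Ω := by
    rw [hΩ.frontier_eq]
    exact ⟨hc.2, hc.1⟩
  have h1 := hd.trans (Metric.infEDist_le_edist_of_mem hyf)
  rw [edist_dist, ENNReal.ofReal_le_ofReal_iff dist_nonneg, dist_comm] at h1
  exact absurd (Metric.mem_ball.1 hy) h1.not_gt

/-- Points of the closure of a subset of `innerSet Ω δ` are centers of balls of radius `δ` that lie
in `Ω`. -/
theorem ball_subset_of_mem_closure_innerSet (hΩ : IsOpen Ω) {δ : ℝ} (hδ : 0 < δ)
    {U : Set (EuclideanSpace ℝ (Fin N))} (hU : U ⊆ innerSet Ω δ) {x : EuclideanSpace ℝ (Fin N)}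
    (hx : x ∈ closure U) : Metric.ball x δ ⊆ Ω := by
  have hd : ENNReal.ofReal δ ≤ Metric.infEDist x (frontier Ω) := by
    have hcl : IsClosed {y | ENNReal.ofReal δ ≤ Metric.infEDist y (frontier Ω)} :=
      isClosed_le continuous_const Metric.continuous_infEDist
    exact closure_minimal (fun y hy ↦ (hU hy).2.le) hcl hx
  refine ball_subset_of_le_infEDist_frontier hΩ ?_ hδ hd
  by_contra hxΩ
  have hxf : x ∈ frontier Ω := by
    rw [hΩ.frontier_eq]
    exact ⟨closure_mono (fun y hy ↦ (hU hy).1) hx, hxΩ⟩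
  rw [Metric.infEDist_zero_of_mem hxf] at hd
  simp only [nonpos_iff_eq_zero, ENNReal.ofReal_eq_zero] at hd
  linarith

/-- A Sobolev function and its gradient have measurable representatives that are globally in
`L^p`. -/
theorem MemSobolevWithGradient.exists_measurable_representatives (hΩ : MeasurableSet Ω)
    (h : MemSobolevWithGradient p Ω u g) :
    ∃ (u' : EuclideanSpace ℝ (Fin N) → ℝ)
      (g' : EuclideanSpace ℝ (Fin N) → EuclideanSpace ℝ (Fin N)),
      Measurable u' ∧ Measurable g' ∧ u =ᵐ[volume.restrict Ω] u' ∧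
      MemLp u' (ENNReal.ofReal p) volume ∧ MemLp g' (ENNReal.ofReal p) volume ∧
      eLpNorm g' (ENNReal.ofReal p) volume = eLpNorm g (ENNReal.ofReal p) (volume.restrict Ω) ∧
      IsWeakGradient Ω u' g' := by
  -- Extension by zero makes convolutions and translates available on the whole space. The extension
  -- need not be Sobolev across ∂Ω; the weak gradient is only tested inside Ω.
  have hu : u =ᵐ[volume.restrict Ω] Ω.indicator (h.memLp.1.mk u) :=
    h.memLp.1.ae_eq_mk.trans (indicator_ae_eq_restrict hΩ).symm
  have hg : g =ᵐ[volume.restrict Ω] Ω.indicator (h.memLp_gradient.1.mk g) :=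
    h.memLp_gradient.1.ae_eq_mk.trans (indicator_ae_eq_restrict hΩ).symm
  refine ⟨Ω.indicator (h.memLp.1.mk u), Ω.indicator (h.memLp_gradient.1.mk g),
    h.memLp.1.stronglyMeasurable_mk.measurable.indicator hΩ,
    h.memLp_gradient.1.stronglyMeasurable_mk.measurable.indicator hΩ, hu, ?_, ?_, ?_, ?_⟩
  · exact (memLp_indicator_iff_restrict hΩ).2 (h.memLp.ae_eq h.memLp.1.ae_eq_mk)
  · exact (memLp_indicator_iff_restrict hΩ).2
      (h.memLp_gradient.ae_eq h.memLp_gradient.1.ae_eq_mk)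
  · rw [eLpNorm_indicator_eq_eLpNorm_restrict hΩ]
    exact (eLpNorm_congr_ae h.memLp_gradient.1.ae_eq_mk).symm
  · intro φ hφ hφc hφt i
    have h1 := h.isWeakGradient φ hφ hφc hφt i
    rw [integral_congr_ae (g := fun x ↦ Ω.indicator (h.memLp.1.mk u) x *
      fderiv ℝ φ x (EuclideanSpace.single i 1)), integral_congr_ae (f := fun x ↦ g x i * φ x)
      (g := fun x ↦ Ω.indicator (h.memLp_gradient.1.mk g) x i * φ x)] at h1
    · exact h1
    · filter_upwards [hg] with x hx
      rw [hx]
    · filter_upwards [hu] with x hx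
      rw [hx]

/-! ### Absorption and conclusion. -/

theorem integral_norm_rpow_eq_toReal_eLpNorm_rpow {S E : Type*} [MeasurableSpace S]
    [NormedAddCommGroup E] {μ : Measure S} {f : S → E} (hp : 0 < p)
    (hf : MemLp f (ENNReal.ofReal p) μ) :
    ∫ x, ‖f x‖ ^ p ∂μ = (eLpNorm f (ENNReal.ofReal p) μ).toReal ^ p := by
  have h0 : 0 ≤ ∫ x, ‖f x‖ ^ p ∂μ := integral_nonneg fun x ↦ by positivity
  rw [hf.eLpNorm_eq_integral_rpow_norm (by simpa using hp) ENNReal.ofReal_ne_top,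
    ENNReal.toReal_ofReal hp.le, ENNReal.toReal_ofReal (by positivity), ← Real.rpow_mul h0,
    inv_mul_cancel₀ hp.ne', Real.rpow_one]

/-- The term x/2 on the right is absorbed on the left, which needs x finite. -/
theorem toReal_le_of_le_two_mul_add_div {x y k : ℝ≥0∞} (hx : x ≠ ⊤) (hy : y ≠ ⊤) (hk : k ≠ ⊤)
    (h : x ≤ 2 * (k * y + (x + y) / 4)) : x.toReal ≤ (4 * k.toReal + 1) * y.toReal := by
  have h1 := ENNReal.toReal_mono (by finiteness) h
  rw [ENNReal.toReal_mul, ENNReal.toReal_add (by finiteness) (by finiteness), ENNReal.toReal_mul,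
    ENNReal.toReal_div, ENNReal.toReal_add hx hy] at h1
  norm_num at h1
  linarith

theorem theorem3p1 (N : ℕ) (p : ℝ) (hp : 1 < p)
    (F : Set (Set (EuclideanSpace ℝ (Fin N))))
    (hF : ∀ Ω ∈ F, IsDomainSet Ω)
    (f1 : ∃ R : ℝ, 0 < R ∧ ∀ Ω ∈ F, Ω ⊆ Metric.ball 0 R)
    (f2 : ∃ q : ℝ≥0∞, ENNReal.ofReal p < q ∧ ∃ CS : ℝ, 0 < CS ∧ ∀ Ω ∈ F,
      ∀ (u : EuclideanSpace ℝ (Fin N) → ℝ)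
        (g : EuclideanSpace ℝ (Fin N) → EuclideanSpace ℝ (Fin N)),
        MemSobolevWithGradient p Ω u g →
          eLpNorm u q (volume.restrict Ω) ≤ ENNReal.ofReal CS * sobolevNorm p Ω u g)
    (f3 : ∀ ε : ℝ, 0 < ε → ∃ δ : ℝ, 0 < δ ∧ ∀ Ω ∈ F,
      ∃ U : Set (EuclideanSpace ℝ (Fin N)),
        IsPreconnected U ∧ U ⊆ innerSet Ω δ ∧ volume (Ω \ U) < ENNReal.ofReal ε) :
    ∃ C : ℝ, 0 < C ∧ ∀ Ω ∈ F,
      ∀ (u : EuclideanSpace ℝ (Fin N) → ℝ)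
        (g : EuclideanSpace ℝ (Fin N) → EuclideanSpace ℝ (Fin N)),
        MemSobolevWithGradient p Ω u g →
          ∫ x in Ω, u x = 0 →
            ∫ x in Ω, |u x| ^ p ≤ C * ∫ x in Ω, ‖g x‖ ^ p := by
  have hp0 : 0 < p := by linarith
  obtain ⟨R, -, hR⟩ := f1
  obtain ⟨q, hq, CS, hCS, hS⟩ := f2
  obtain ⟨ε, hε, hsmall⟩ := exists_eLpNorm_restrict_le_quarter N hp hq hCS
  -- Half of ε, so that Ω itself has measure at most ε when A fills less than half of it.
  obtain ⟨δ, hδ, hU⟩ := f3 (ε / 2) (half_pos hε)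
  obtain ⟨K, hK, hPoin⟩ := exists_eLpNorm_sub_const_le N hp R hδ
  refine ⟨(4 * K.toReal + 1) ^ p, by positivity, fun Ω hΩ u g hug hmean ↦ ?_⟩
  have hΩo : IsOpen Ω := (hF Ω hΩ).1
  have hfin : IsFiniteMeasure (volume.restrict Ω) :=
    isFiniteMeasure_restrict.2 ((measure_mono (hR Ω hΩ)).trans_lt measure_ball_lt_top).ne
  obtain ⟨U, hUc, hUi, hUv⟩ := hU Ω hΩ
  -- U need not be measurable. Its closure is, stays preconnected, and keeps the δ-balls inside Ω.
  set A := closure U with hA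
  have hAm : MeasurableSet A := isClosed_closure.measurableSet
  have hAb (x) (hx : x ∈ A) : Metric.ball x δ ⊆ Ω :=
    ball_subset_of_mem_closure_innerSet hΩo hδ hUi hx
  have hAΩ : A ⊆ Ω := fun x hx ↦ hAb x hx (Metric.mem_ball_self hδ)
  have hdiff : volume (Ω \ A) ≤ ENNReal.ofReal (ε / 2) :=
    (measure_mono (Set.sdiff_subset_sdiff_right subset_closure)).trans hUv.le
  have hsm := hsmall Ω u g hug.memLp.1 (hS Ω hΩ u g hug)
  set X := eLpNorm u (ENNReal.ofReal p) (volume.restrict Ω) with hX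
  set Y := eLpNorm g (ENNReal.ofReal p) (volume.restrict Ω) with hY
  have hresA : (volume.restrict Ω).restrict A = volume.restrict A := by
    rw [Measure.restrict_restrict hAm, Set.inter_eq_left.2 hAΩ]
  have hresAc : (volume.restrict Ω).restrict Aᶜ = volume.restrict (Ω \ A) := by
    rw [Measure.restrict_restrict hAm.compl, Set.inter_comm, Set.sdiff_eq]
  have key : X ≤ 2 * (K * Y + (X + Y) / 4) := by
    -- In the first case, which includes U empty, non-concentration applies to all of Ω and neither
    -- the zero mean nor the estimate on A is needed.
    rcases le_total (volume A) (volume (Ω \ A)) with hle | hle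
    · have hvol : volume Ω ≤ ENNReal.ofReal ε := by
        rw [← measure_sdiff_add_inter Ω hAm, Set.inter_eq_right.2 hAΩ, ← add_halves ε,
          ENNReal.ofReal_add (by positivity) (by positivity)]
        exact add_le_add hdiff (hle.trans hdiff)
      calc X ≤ (X + Y) / 4 := hsm Ω subset_rfl hvol
        _ ≤ K * Y + (X + Y) / 4 := le_add_self
        _ ≤ _ := le_mul_of_one_le_left' one_le_two
    · obtain ⟨u', g', hum, hgm, huu, hup, hgp, hgY, hw⟩ :=
        hug.exists_measurable_representatives hΩo.measurableSet
      obtain ⟨c, hc⟩ := hPoin Ω A u' g' hAm hUc.closure (hAΩ.trans (hR Ω hΩ)) hAb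
        (hup.locallyIntegrable (ENNReal.one_le_ofReal.2 hp.le)) hum hgp hgm hw
      have hcu : eLpNorm (fun x ↦ u x - c) (ENNReal.ofReal p) (volume.restrict A) ≤ K * Y := by
        rw [hY, ← hgY]
        refine le_trans (le_of_eq (eLpNorm_congr_ae ?_)) hc
        filter_upwards [ae_restrict_of_ae_restrict_of_subset hAΩ huu] with x hx
        rw [hx]
      have hle' : (volume.restrict Ω) Aᶜ ≤ (volume.restrict Ω) A := by
        rwa [Measure.restrict_apply hAm.compl, Measure.restrict_apply hAm, Set.inter_comm,
          ← Set.sdiff_eq, Set.inter_eq_left.2 hAΩ]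
      have hmain := eLpNorm_le_of_integral_eq_zero hp hug.memLp hmean hAm hle' c
      rw [hresA, hresAc] at hmain
      refine hmain.trans ?_
      gcongr
      exact hsm _ Set.sdiff_subset
        (hdiff.trans (ENNReal.ofReal_le_ofReal (by linarith)))
  have hreal := toReal_le_of_le_two_mul_add_div hug.memLp.2.ne hug.memLp_gradient.2.ne hK key
  simp_rw [← Real.norm_eq_abs]
  rw [integral_norm_rpow_eq_toReal_eLpNorm_rpow hp0 hug.memLp,
    integral_norm_rpow_eq_toReal_eLpNorm_rpow hp0 hug.memLp_gradient,
    ← Real.mul_rpow (by positivity) ENNReal.toReal_nonneg]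
  exact Real.rpow_le_rpow ENNReal.toReal_nonneg hreal hp0.le
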